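/- Let $d\in\mathbb N$, $0<\alpha<d$ and $\beta\in(d-\alpha,d]$. There exist constants $C=C(d,\alpha,\beta)>0$ and $\gamma=\gamma(d,\alpha,\beta)>0$ with the following property. Let $\mu$ be a locally finite (nonnegative Borel) measure on $\mathbb R^d$ and let $B=B(z,R)$ be an open ball such that $$\|\mu\|_{\mathcal M^{d-\alpha}(B)}:=\sup_{x\in B,\ r>0}\frac{\mu(B(x,r)\cap B)}{r^{d-\alpha}}<\infty .$$ Write $2B=B(z,2R)$, $r(2B)=2R$, and let $\mu_B=\mu|_B$ be the restriction of $\mu$ to $B$. Then $$\frac1{r(2B)^\beta}\int_{2B}\exp\left(\frac{\gamma\, I_\alpha\mu_B(x)}{\|\mu\|_{\mathcal M^{d-\alpha}(B)}}\right)d\mathcal H^\beta_\infty(x)\le C .$$ In particular, if $\mu$ is concentrated on $B$, this holds with $I_\alpha\mu$ in place of $I_\alpha\mu_B$. Here $$I_\alpha\nu(x)=\frac1{\gamma(\alpha)}\int_{\mathbb R^d}\frac{d\nu(y)}{|x-y|^{d-\alpha}}\in[0,\infty],\qquad \gamma(\alpha)=\frac{\pi^{d/2}\,2^\alpha\,\Gamma(\alpha/2)}{\Gamma((d-\alpha)/2)},$$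 $\mathcal H^\beta_\infty(E)=\inf\{\sum_{i=1}^\infty \omega_\beta r_i^\beta : E\subseteq\bigcup_{i=1}^\infty B(x_i,r_i)\}$ is the Hausdorff content with $\omega_\beta=\pi^{\beta/2}/\Gamma(\tfrac\beta2+1)$, the integral is the Choquet integral $\int_\Omega f\,d\mathcal H^\beta_\infty=\int_0^\infty\mathcal H^\beta_\infty(\{x\in\Omega: f(x)>t\})\,dt$, $\exp(\infty)=\infty$, and if $\mu(B)=0$ the quotient $0/0$ in the exponent is read as $0$. -/

import Mathlib

open MeasureTheory Metric
open scoped ENNReal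

noncomputable section

/-- The normalization constant `ω_β = π^{β/2} / Γ(β/2 + 1)` of the Hausdorff content. -/
def contentConstant (β : ℝ) : ℝ :=
  Real.pi ^ (β / 2) / Real.Gamma (β / 2 + 1)

/-- The `β`-dimensional Hausdorff content of a set `A ⊆ ℝ^d`: the infimum of `∑ ω_β r_i ^ β` over
all countable covers of `A` by open balls of radii `r_i`. (A ball of radius `0` is empty and, for
`β > 0`, contributes `0`, so finite covers are included.) -/
def hausdorffContent {d : ℕ} (β : ℝ) (A : Set (EuclideanSpace ℝ (Fin d))) : ℝ≥0∞ :=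
  ⨅ (c : ℕ → EuclideanSpace ℝ (Fin d)) (r : ℕ → ℝ) (_ : ∀ i, 0 ≤ r i)
    (_ : A ⊆ ⋃ i, ball (c i) (r i)), ∑' i, ENNReal.ofReal (contentConstant β * r i ^ β)

/-- The Choquet integral `∫_Ω f dH = ∫_0^∞ H({x ∈ Ω : f x > t}) dt` of a nonnegative function with
respect to a set function `H`. -/
def choquetIntegral {X : Type*} (H : Set X → ℝ≥0∞) (Ω : Set X) (f : X → ℝ≥0∞) : ℝ≥0∞ :=
  ∫⁻ t in Set.Ioi (0 : ℝ), H {x ∈ Ω | ENNReal.ofReal t < f x}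

/-- The normalization constant `π^{d/2} 2^α Γ(α/2) / Γ((d-α)/2)` of the Riesz potential. -/
def rieszConstant (d : ℕ) (α : ℝ) : ℝ :=
  Real.pi ^ ((d : ℝ) / 2) * 2 ^ α * Real.Gamma (α / 2) / Real.Gamma (((d : ℝ) - α) / 2)

/-- The Riesz potential of order `α` of a (nonnegative) measure on `ℝ^d`, with values in `[0, ∞]`.
For `α < d` the kernel `|x - y|^{-(d-α)}` equals `∞` on the diagonal. -/
def rieszPotential {d : ℕ} (α : ℝ) (μ : Measure (EuclideanSpace ℝ (Fin d)))
    (x : EuclideanSpace ℝ (Fin d)) : ℝ≥0∞ :=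
  (ENNReal.ofReal (rieszConstant d α))⁻¹ *
    ∫⁻ y, (ENNReal.ofReal (‖x - y‖ ^ ((d : ℝ) - α)))⁻¹ ∂μ

/-- The local Morrey norm `sup_{x ∈ Ω, r > 0} μ(B(x,r) ∩ Ω) / r^s` of a (nonnegative) measure;
`μ` belongs to the Morrey space of `Ω` exactly when it is finite. -/
def morreyNorm {d : ℕ} (s : ℝ) (μ : Measure (EuclideanSpace ℝ (Fin d)))
    (Ω : Set (EuclideanSpace ℝ (Fin d))) : ℝ≥0∞ :=
  ⨆ (x ∈ Ω) (r : ℝ) (_ : 0 < r), μ (ball x r ∩ Ω) / ENNReal.ofReal (r ^ s)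

end

/-! Put s = d - α, ν = μ restricted to B, M the Morrey norm. Cut the kernel integral at x ∈ 2B into
dyadic shells. The growth ν(B(x,r)) ≤ 3^s M r^s bounds every shell by the same constant 6^s M. If
also ν(B(x,r)) ≤ K r^β below radius ρ_N = 2^(-N)·3R, the shells after the N-th decay geometrically
because β > s, so the integral is at most 6^s M (N + S) with S = (1 - 2^(s-β))⁻¹
(`lintegral_inv_norm_rpow_le`). The points violating the second bound have content at most a
constant times ν(B)/K, by Vitali covering (`hausdorffContent_setOf_lt_measure_closedBall_le`). As K
is comparable to M ρ_N^(s-β), this is of order R^β 2^(-N(β-s)). The content thus decays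
exponentially in the level of the potential, and a small γ makes the exponential integrable. -/

theorem contentConstant_pos {β : ℝ} (hβ : 0 < β) : 0 < contentConstant β := by
  unfold contentConstant
  have := Real.Gamma_pos_of_pos (s := β / 2 + 1) (by linarith)
  have := Real.pi_pos
  positivity

theorem rieszConstant_pos {d : ℕ} {α : ℝ} (hα : 0 < α) (hαd : α < d) : 0 < rieszConstant d α := by
  unfold rieszConstant
  have := Real.Gamma_pos_of_pos (s := α / 2) (by linarith)
  have := Real.Gamma_pos_of_pos (s := ((d : ℝ) - α) / 2) (by linarith)
  have := Real.pi_pos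
  positivity

/-! ### Hausdorff content: covers and a weak-type estimate -/

theorem hausdorffContent_mono {d : ℕ} (β : ℝ) {A B : Set (EuclideanSpace ℝ (Fin d))}
    (h : A ⊆ B) : hausdorffContent β A ≤ hausdorffContent β B := by
  unfold hausdorffContent
  gcongr with c r hr
  exact le_iInf fun hB => iInf_le _ (h.trans hB)

/-- The content is bounded by the sum over a cover indexed by any countable type. -/
theorem hausdorffContent_le_tsum {d : ℕ} {β : ℝ} (hβ : 0 < β) {ι : Type*} [Countable ι]
    {A : Set (EuclideanSpace ℝ (Fin d))} (c : ι → EuclideanSpace ℝ (Fin d)) (r : ι → ℝ)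
    (hr : ∀ i, 0 ≤ r i) (hA : A ⊆ ⋃ i, ball (c i) (r i)) :
    hausdorffContent β A ≤ ∑' i, ENNReal.ofReal (contentConstant β * r i ^ β) := by
  obtain ⟨e, he⟩ := exists_injective_nat ι
  unfold hausdorffContent
  refine iInf_le_of_le (Function.extend e c 0) <| iInf_le_of_le (Function.extend e r 0) <|
    iInf_le_of_le ?_ <| iInf_le_of_le ?_ ?_
  · intro n
    by_cases h : ∃ i, e i = n
    · obtain ⟨i, rfl⟩ := h
      rw [he.extend_apply]
      exact hr i
    · rw [Function.extend_apply' _ _ _ h]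
      rfl
  · refine hA.trans (Set.iUnion_subset fun i => ?_)
    refine Set.subset_iUnion_of_subset (e i) ?_
    rw [he.extend_apply, he.extend_apply]
  · rw [← tsum_extend_zero he]
    refine ENNReal.tsum_le_tsum fun n => ?_
    by_cases h : ∃ i, e i = n
    · obtain ⟨i, rfl⟩ := h
      rw [he.extend_apply, he.extend_apply]
    · rw [Function.extend_apply' _ _ _ h, Function.extend_apply' _ _ _ h]
      simp [Real.zero_rpow hβ.ne']

theorem hausdorffContent_ball_le {d : ℕ} {β : ℝ} (hβ : 0 < β) (z : EuclideanSpace ℝ (Fin d))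
    {r : ℝ} (hr : 0 ≤ r) :
    hausdorffContent β (ball z r) ≤ ENNReal.ofReal (contentConstant β * r ^ β) := by
  simpa using hausdorffContent_le_tsum (A := ball z r) hβ (fun _ : Unit => z) (fun _ => r)
    (fun _ => hr) (Set.subset_iUnion (fun _ : Unit => ball z r) ())

/-- Weak-type estimate: the set of points around which `ν` charges some small ball by more than
`K r ^ β` has content at most a constant times `ν univ / K`. -/
theorem hausdorffContent_setOf_lt_measure_closedBall_le {d : ℕ} {β K ρ : ℝ} (hβ : 0 < β)
    (hK : 0 < K) (ν : Measure (EuclideanSpace ℝ (Fin d))) :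
    hausdorffContent β {x | ∃ r, 0 < r ∧ r ≤ ρ ∧ ENNReal.ofReal (K * r ^ β) < ν (closedBall x r)} ≤
      ENNReal.ofReal (contentConstant β * 6 ^ β / K) * ν Set.univ := by
  have hω := contentConstant_pos hβ
  set E := {x | ∃ r, 0 < r ∧ r ≤ ρ ∧ ENNReal.ofReal (K * r ^ β) < ν (closedBall x r)} with hE
  choose! r hr0 hrρ hrν using fun x (hx : x ∈ E) => hx
  obtain ⟨u, huE, hdisj, hcov⟩ := Vitali.exists_disjoint_subfamily_covering_enlargement_closedBall
    E id r ρ hrρ 5 (by norm_num)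
  have hcount : u.Countable := hdisj.countable_of_nonempty_interior fun x hx => by
    rw [interior_closedBall _ (hr0 x (huE hx)).ne']
    exact nonempty_ball.2 (hr0 x (huE hx))
  have := hcount.to_subtype
  calc hausdorffContent β E
      -- The factor is 6 rather than Vitali's 5 because the content uses open balls.
      ≤ ∑' i : u, ENNReal.ofReal (contentConstant β * (6 * r i) ^ β) := by
        refine hausdorffContent_le_tsum hβ (fun i : u => (i : EuclideanSpace ℝ (Fin d))) _
          (fun i => ?_) fun x hx => ?_
        · have := hr0 _ (huE i.2)
          positivity
        · obtain ⟨b, hb, hxb⟩ := hcov x hx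
          refine Set.mem_iUnion.2 ⟨⟨b, hb⟩, ?_⟩
          have h1 := hr0 b (huE hb)
          have h2 := hxb (mem_closedBall_self (hr0 x hx).le)
          rw [mem_closedBall] at h2
          rw [mem_ball]
          simp only [id] at h2 ⊢
          linarith
    _ ≤ ∑' i : u, ENNReal.ofReal (contentConstant β * 6 ^ β / K) * ν (closedBall (i : _) (r i)) := by
        refine ENNReal.tsum_le_tsum fun i => ?_
        have h1 := hr0 _ (huE i.2)
        calc ENNReal.ofReal (contentConstant β * (6 * r i) ^ β)
            = ENNReal.ofReal (contentConstant β * 6 ^ β / K) * ENNReal.ofReal (K * r i ^ β) := by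
              rw [← ENNReal.ofReal_mul (by positivity), Real.mul_rpow (by norm_num) h1.le]
              congr 1
              field_simp
          _ ≤ _ := by gcongr; exact (hrν _ (huE i.2)).le
    _ = ENNReal.ofReal (contentConstant β * 6 ^ β / K) * ν (⋃ i ∈ u, closedBall i (r i)) := by
        rw [ENNReal.tsum_mul_left]
        congr 1
        exact (measure_biUnion hcount hdisj fun _ _ => measurableSet_closedBall).symm
    _ ≤ _ := by gcongr; exact Set.subset_univ _

/-! ### Pointwise bound for the Riesz kernel integral -/

/-- The kernel is infinite on the diagonal, so the dyadic shells, which omit the centre, suffice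
only if the centre carries no mass. -/
theorem measure_singleton_eq_zero_of_closedBall_le {X : Type*} [PseudoMetricSpace X]
    [MeasurableSpace X] {s A : ℝ} (hs : 0 < s) (ν : Measure X) (x : X)
    (hgrowth : ∀ r, 0 < r → ν (closedBall x r) ≤ ENNReal.ofReal (A * r ^ s)) : ν {x} = 0 := by
  have hlim : Filter.Tendsto (fun r : ℝ => ENNReal.ofReal (A * r ^ s)) (nhdsWithin 0 (Set.Ioi 0))
      (nhds 0) := by
    have : ContinuousAt (fun r : ℝ => ENNReal.ofReal (A * r ^ s)) 0 :=
      ENNReal.continuous_ofReal.continuousAt.comp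
        (continuousAt_const.mul (Real.continuousAt_rpow_const _ _ (Or.inr hs.le)))
    have h := this.tendsto
    simp only [Real.zero_rpow hs.ne', mul_zero, ENNReal.ofReal_zero] at h
    exact h.mono_left nhdsWithin_le_nhds
  refine le_antisymm (ge_of_tendsto hlim ?_) zero_le
  filter_upwards [self_mem_nhdsWithin] with r hr
  exact (measure_mono (by simpa using (Set.mem_Ioi.1 hr).le)).trans (hgrowth r hr)

/-- A series whose first `N` terms are at most `c` and which then decays geometrically. -/
theorem ENNReal.tsum_le_of_le_of_le_geometric {f : ℕ → ℝ≥0∞} {c q : ℝ} (hc : 0 ≤ c) (hq0 : 0 ≤ q)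
    (hq : q < 1) (N : ℕ) (h1 : ∀ k, f k ≤ ENNReal.ofReal c)
    (h2 : ∀ k, f (k + N) ≤ ENNReal.ofReal (c * q ^ k)) :
    ∑' k, f k ≤ ENNReal.ofReal (c * (N + (1 - q)⁻¹)) := by
  calc ∑' k, f k
      = ∑ k ∈ Finset.range N, f k + ∑' k, f (k + N) :=
        (Summable.sum_add_tsum_nat_add' ENNReal.summable).symm
    _ ≤ ∑ _k ∈ Finset.range N, ENNReal.ofReal c + ∑' k, ENNReal.ofReal (c * q ^ k) :=
        add_le_add (Finset.sum_le_sum fun k _ => h1 k) (ENNReal.tsum_le_tsum h2)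
    _ = _ := by
        rw [← ENNReal.ofReal_tsum_of_nonneg (fun k => by positivity)
          ((summable_geometric_of_lt_one hq0 hq).mul_left _), tsum_mul_left,
          tsum_geometric_of_lt_one hq0 hq, Finset.sum_const, Finset.card_range, nsmul_eq_mul,
          ← ENNReal.ofReal_natCast, ← ENNReal.ofReal_mul (by positivity),
          ← ENNReal.ofReal_add (by positivity)
            (mul_nonneg (by positivity) (inv_nonneg.2 (by linarith)))]
        congr 1
        ring

/-- Dyadic estimate of the Riesz kernel integral at a point. -/
theorem lintegral_inv_norm_rpow_le {d : ℕ} {s ε A ρ : ℝ} (hs : 0 < s) (hε : 0 < ε) (hA : 0 ≤ A)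
    (hρ : 0 < ρ) (N : ℕ) (ν : Measure (EuclideanSpace ℝ (Fin d))) (x : EuclideanSpace ℝ (Fin d))
    (hsupp : ν (closedBall x ρ)ᶜ = 0)
    (hgrowth : ∀ r, 0 < r → ν (closedBall x r) ≤ ENNReal.ofReal (A * r ^ s))
    (hdecay : ∀ r, 0 < r → r ≤ (1 / 2) ^ N * ρ →
      ν (closedBall x r) ≤ ENNReal.ofReal (A / ((1 / 2) ^ N * ρ) ^ ε * r ^ (s + ε))) :
    ∫⁻ y, (ENNReal.ofReal (‖x - y‖ ^ s))⁻¹ ∂ν ≤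
      ENNReal.ofReal (2 ^ s * A * (N + (1 - (1 / 2) ^ ε)⁻¹)) := by
  have hpt := measure_singleton_eq_zero_of_closedBall_le hs ν x hgrowth
  let S : ℕ → Set (EuclideanSpace ℝ (Fin d)) := fun k =>
    closedBall x ((1 / 2) ^ k * ρ) \ closedBall x ((1 / 2) ^ (k + 1) * ρ)
  have hS : ∀ k, MeasurableSet (S k) := fun k =>
    measurableSet_closedBall.diff measurableSet_closedBall
  have hae : ∀ᵐ y ∂ν, y ∈ ⋃ k, S k := by
    have h1 : ∀ᵐ y ∂ν, y ∈ closedBall x ρ := by rwa [ae_iff]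
    have h2 : ∀ᵐ y ∂ν, y ≠ x := by simpa [ae_iff] using hpt
    filter_upwards [h1, h2] with y hy hne
    rw [mem_closedBall] at hy
    have hpos := dist_pos.2 hne
    obtain ⟨k, hk1, hk2⟩ := exists_nat_pow_near_of_lt_one (x := dist y x / ρ) (y := (1 / 2 : ℝ))
      (by positivity) ((div_le_one hρ).2 hy) (by norm_num) (by norm_num)
    rw [lt_div_iff₀ hρ] at hk1
    rw [div_le_iff₀ hρ] at hk2
    exact Set.mem_iUnion.2 ⟨k, mem_closedBall.2 hk2, fun h => absurd hk1 (mem_closedBall.1 h).not_gt⟩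
  have hshell : ∀ k, ∫⁻ y in S k, (ENNReal.ofReal (‖x - y‖ ^ s))⁻¹ ∂ν ≤
      ENNReal.ofReal ((((1 / 2) ^ (k + 1) * ρ) ^ s)⁻¹) * ν (closedBall x ((1 / 2) ^ k * ρ)) := by
    intro k
    calc ∫⁻ y in S k, (ENNReal.ofReal (‖x - y‖ ^ s))⁻¹ ∂ν
        ≤ ∫⁻ y in S k, ENNReal.ofReal ((((1 / 2) ^ (k + 1) * ρ) ^ s)⁻¹) ∂ν := by
          refine setLIntegral_mono' (hS k) fun y hy => ?_
          rw [ENNReal.ofReal_inv_of_pos (by positivity), ENNReal.inv_le_inv]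
          have := hy.2
          rw [mem_closedBall, not_le, dist_eq_norm, norm_sub_rev] at this
          gcongr
      _ = ENNReal.ofReal ((((1 / 2) ^ (k + 1) * ρ) ^ s)⁻¹) * ν (S k) := by simp
      _ ≤ _ := by gcongr; exact Set.sdiff_subset
  have hhalf : ∀ k : ℕ, ((1 / 2 : ℝ) ^ (k + 1) * ρ) ^ s * 2 ^ s = ((1 / 2) ^ k * ρ) ^ s := by
    intro k
    rw [← Real.mul_rpow (by positivity) (by norm_num)]
    congr 1
    rw [pow_succ]
    ring
  -- The kernel is evaluated at the inner radius and the mass at the outer one, twice as large: the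
  -- powers cancel up to 2^s.
  have hbd1 : ∀ k, ENNReal.ofReal ((((1 / 2) ^ (k + 1) * ρ) ^ s)⁻¹) *
      ν (closedBall x ((1 / 2) ^ k * ρ)) ≤ ENNReal.ofReal (2 ^ s * A) := by
    intro k
    refine (mul_le_mul_right (hgrowth _ (by positivity)) _).trans ?_
    rw [← ENNReal.ofReal_mul (by positivity)]
    refine ENNReal.ofReal_le_ofReal (le_of_eq ?_)
    rw [← hhalf k]
    have : 0 < ((1 / 2 : ℝ) ^ (k + 1) * ρ) ^ s := by positivity
    field_simp
  -- The two growth bounds agree at radius (1/2)^N ρ; each further halving gains a factor (1/2)^ε.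
  have hbd2 : ∀ k, ENNReal.ofReal ((((1 / 2) ^ (k + N + 1) * ρ) ^ s)⁻¹) *
      ν (closedBall x ((1 / 2) ^ (k + N) * ρ)) ≤
        ENNReal.ofReal (2 ^ s * A * ((1 / 2) ^ ε) ^ k) := by
    intro k
    refine (mul_le_mul_right (hdecay _ (by positivity) ?_) _).trans ?_
    · gcongr ?_ * _
      exact pow_le_pow_of_le_one (by norm_num) (by norm_num) (Nat.le_add_left _ _)
    rw [← ENNReal.ofReal_mul (by positivity)]
    refine ENNReal.ofReal_le_ofReal (le_of_eq ?_)
    have h1 : ((1 / 2 : ℝ) ^ (k + N) * ρ) ^ ε = ((1 / 2) ^ ε) ^ k * ((1 / 2) ^ N * ρ) ^ ε := by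
      rw [pow_add, mul_assoc, Real.mul_rpow (by positivity) (by positivity),
        Real.rpow_pow_comm (by norm_num)]
    rw [Real.rpow_add (by positivity), h1, ← hhalf (k + N)]
    have : 0 < ((1 / 2 : ℝ) ^ (k + N + 1) * ρ) ^ s := by positivity
    have : 0 < ((1 / 2 : ℝ) ^ N * ρ) ^ ε := by positivity
    field_simp
  have hq : (1 / 2 : ℝ) ^ ε < 1 := Real.rpow_lt_one (by norm_num) (by norm_num) hε
  have hq0 : (0 : ℝ) < (1 / 2 : ℝ) ^ ε := by positivity
  calc ∫⁻ y, (ENNReal.ofReal (‖x - y‖ ^ s))⁻¹ ∂ν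
      = ∫⁻ y in ⋃ k, S k, (ENNReal.ofReal (‖x - y‖ ^ s))⁻¹ ∂ν := by
        rw [Measure.restrict_eq_self_of_ae_mem hae]
    _ ≤ ∑' k, ∫⁻ y in S k, (ENNReal.ofReal (‖x - y‖ ^ s))⁻¹ ∂ν := lintegral_iUnion_le _ _
    _ ≤ ∑' k, ENNReal.ofReal ((((1 / 2) ^ (k + 1) * ρ) ^ s)⁻¹) *
          ν (closedBall x ((1 / 2) ^ k * ρ)) := ENNReal.tsum_le_tsum hshell
    _ ≤ _ := ENNReal.tsum_le_of_le_of_le_geometric (by positivity) hq0.le hq N hbd1 hbd2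

/-! ### Morrey growth and decay of the superlevel sets -/

theorem measure_ball_inter_le_morreyNorm {d : ℕ} (s : ℝ) (μ : Measure (EuclideanSpace ℝ (Fin d)))
    {Ω : Set (EuclideanSpace ℝ (Fin d))} {x : EuclideanSpace ℝ (Fin d)} (hx : x ∈ Ω) {r : ℝ}
    (hr : 0 < r) : μ (ball x r ∩ Ω) ≤ morreyNorm s μ Ω * ENNReal.ofReal (r ^ s) := by
  rw [← ENNReal.div_le_iff (by simpa using Real.rpow_pos_of_pos hr s) ENNReal.ofReal_ne_top]
  exact le_iSup₂_of_le x hx (le_iSup₂_of_le r hr le_rfl)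

/-- The Morrey norm only tests centres in Ω, whereas the potential is needed on all of 2B.
Recentring at a point of Ω in the ball costs the factor 3. -/
theorem measure_closedBall_inter_le_morreyNorm {d : ℕ} (s : ℝ)
    (μ : Measure (EuclideanSpace ℝ (Fin d))) (Ω : Set (EuclideanSpace ℝ (Fin d)))
    (x : EuclideanSpace ℝ (Fin d)) {r : ℝ} (hr : 0 < r) :
    μ (closedBall x r ∩ Ω) ≤ morreyNorm s μ Ω * ENNReal.ofReal ((3 * r) ^ s) := by
  rcases (closedBall x r ∩ Ω).eq_empty_or_nonempty with h | ⟨y, hy, hyΩ⟩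
  · simp [h]
  · refine le_trans (measure_mono ?_)
      (measure_ball_inter_le_morreyNorm s μ hyΩ (by positivity : 0 < 3 * r))
    refine Set.inter_subset_inter_left _ fun w hw => ?_
    rw [mem_closedBall] at hw hy
    rw [mem_ball]
    have := dist_triangle_right w y x
    linarith

/-- Exponential decay of the content of the superlevel sets of the Riesz kernel integral. -/
theorem hausdorffContent_setOf_lt_lintegral_le {d : ℕ} {s β M R : ℝ} (hs : 0 < s) (hβ : s < β)
    (hM : 0 < M) (hR : 0 < R) (μ : Measure (EuclideanSpace ℝ (Fin d)))
    (z : EuclideanSpace ℝ (Fin d)) (hμ : morreyNorm s μ (ball z R) = ENNReal.ofReal M) (N : ℕ) :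
    hausdorffContent β {x ∈ ball z (2 * R) |
        ENNReal.ofReal (2 ^ s * (3 ^ s * M) * (N + (1 - (1 / 2) ^ (β - s))⁻¹)) <
          ∫⁻ y, (ENNReal.ofReal (‖x - y‖ ^ s))⁻¹ ∂μ.restrict (ball z R)} ≤
      ENNReal.ofReal (contentConstant β * 6 ^ β * 3 ^ (β - s) / 3 ^ s * R ^ β *
        ((1 / 2) ^ (β - s)) ^ N) := by
  have hω := contentConstant_pos (hs.trans hβ)
  -- K makes K r^β equal to 3^s M r^s at the threshold radius r = (1/2)^N · 3R.
  set K := 3 ^ s * M / ((1 / 2) ^ N * (3 * R)) ^ (β - s) with hK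
  have hKpos : 0 < K := by positivity
  have huniv : μ.restrict (ball z R) Set.univ ≤ ENNReal.ofReal (M * R ^ s) := by
    have := measure_ball_inter_le_morreyNorm s μ (mem_ball_self (x := z) hR) hR
    rwa [Set.inter_self, hμ, ← ENNReal.ofReal_mul hM.le, ← Measure.restrict_apply_univ] at this
  refine (hausdorffContent_mono β ?_).trans
    ((hausdorffContent_setOf_lt_measure_closedBall_le (ρ := (1 / 2) ^ N * (3 * R)) (hs.trans hβ)
      hKpos (μ.restrict (ball z R))).trans ?_)
  · rintro x ⟨hx, hlt⟩
    by_contra hcon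
    simp only [Set.mem_ofPred_eq, not_exists, not_and, not_lt] at hcon
    refine absurd hlt (not_lt.2 ?_)
    -- Radius 3R works since x ∈ 2B puts B inside the closed ball of radius 3R about x.
    refine lintegral_inv_norm_rpow_le hs (sub_pos.2 hβ) (by positivity)
      (by positivity : 0 < 3 * R) N _ x ?_ ?_ ?_
    · rw [Measure.restrict_apply measurableSet_closedBall.compl]
      convert measure_empty (μ := μ)
      refine Set.disjoint_iff_inter_eq_empty.1 (Set.disjoint_compl_left_iff_subset.2 fun y hy => ?_)
      rw [mem_ball] at hx hy
      rw [mem_closedBall]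
      have := dist_triangle_right y x z
      linarith
    · intro r hr
      rw [Measure.restrict_apply measurableSet_closedBall]
      refine (measure_closedBall_inter_le_morreyNorm s μ _ x hr).trans (le_of_eq ?_)
      rw [hμ, ← ENNReal.ofReal_mul hM.le, Real.mul_rpow (by norm_num) hr.le]
      congr 1
      ring
    · intro r hr hrN
      rw [add_sub_cancel]
      exact hcon r hr hrN
  · refine (mul_le_mul_right huniv _).trans ?_
    rw [← ENNReal.ofReal_mul (by positivity)]
    refine ENNReal.ofReal_le_ofReal (le_of_eq ?_)
    have h1 : R ^ β = R ^ (β - s) * R ^ s := by rw [← Real.rpow_add hR, sub_add_cancel]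
    have h2 : ((1 / 2 : ℝ) ^ N * (3 * R)) ^ (β - s) =
        ((1 / 2) ^ (β - s)) ^ N * (3 ^ (β - s) * R ^ (β - s)) := by
      rw [Real.mul_rpow (by positivity) (by positivity), Real.mul_rpow (by norm_num) hR.le,
        Real.rpow_pow_comm (by norm_num)]
    rw [hK, h1, h2]
    have : 0 < (1 / 2 : ℝ) ^ (β - s) := by positivity
    have : 0 < (3 : ℝ) ^ (β - s) := by positivity
    have : 0 < R ^ (β - s) := by positivity
    have : 0 < (3 : ℝ) ^ s := by positivity
    field_simp

/-! ### Integration over the levels and the theorem -/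

/-- A Choquet integral is finite if the superlevel sets decay fast enough along a geometric
sequence of levels. -/
theorem choquetIntegral_le_of_exp_decay {X : Type*} {H : Set X → ℝ≥0∞} (hH : Monotone H)
    (Ω : Set X) (F : X → ℝ≥0∞) {a S b : ℝ} (ha : 0 < a) (hb : 0 ≤ b)
    (hΩ : H Ω ≤ ENNReal.ofReal b)
    (hdecay : ∀ N : ℕ, H {x ∈ Ω | ENNReal.ofReal (Real.exp (a * (N + S))) < F x} ≤
      ENNReal.ofReal (b * Real.exp (-(2 * a)) ^ N)) :
    choquetIntegral H Ω F ≤ ENNReal.ofReal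
      ((Real.exp (a * S) + Real.exp (a * (S + 1)) * (1 - Real.exp (-a))⁻¹) * b) := by
  set τ : ℕ → ℝ := fun N => Real.exp (a * (N + S)) with hτ
  have hτlim : Filter.Tendsto τ Filter.atTop Filter.atTop :=
    Real.tendsto_exp_atTop.comp (Filter.Tendsto.const_mul_atTop ha
      (Filter.tendsto_atTop_add_const_right _ _ tendsto_natCast_atTop_atTop))
  have hcover : Set.Ioi (0 : ℝ) ⊆ Set.Ioo 0 (τ 0) ∪ ⋃ N, Set.Ico (τ N) (τ (N + 1)) := by
    intro t ht
    by_cases h : t < τ 0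
    · exact Or.inl ⟨ht, h⟩
    · right
      have hex : ∃ n, t < τ n := (hτlim.eventually_gt_atTop t).exists
      classical
      have hfind := Nat.find_spec hex
      obtain ⟨n, hn⟩ := Nat.exists_eq_succ_of_ne_zero
        (fun h0 : Nat.find hex = 0 => h (h0 ▸ hfind))
      refine Set.mem_iUnion.2 ⟨n, not_lt.1 (Nat.find_min hex (by omega)), ?_⟩
      rw [hn] at hfind
      exact hfind
  have hq : Real.exp (-a) < 1 := Real.exp_lt_one_iff.2 (by linarith)
  have hinit : ∫⁻ t in Set.Ioo 0 (τ 0), H {x ∈ Ω | ENNReal.ofReal t < F x} ≤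
      ENNReal.ofReal (Real.exp (a * S) * b) := by
    calc _ ≤ ∫⁻ _ in Set.Ioo 0 (τ 0), ENNReal.ofReal b :=
          setLIntegral_mono' measurableSet_Ioo fun t _ => (hH (Set.sep_subset _ _)).trans hΩ
      _ = _ := by
          rw [setLIntegral_const, Real.volume_Ioo, ← ENNReal.ofReal_mul hb, mul_comm]
          simp [hτ]
  -- Levels grow by e^a per step while contents shrink by e^(-2a), leaving a net ratio e^(-a).
  have hstep : ∀ N, ∫⁻ t in Set.Ico (τ N) (τ (N + 1)), H {x ∈ Ω | ENNReal.ofReal t < F x} ≤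
      ENNReal.ofReal (b * Real.exp (a * (S + 1)) * Real.exp (-a) ^ N) := by
    intro N
    calc _ ≤ ∫⁻ _ in Set.Ico (τ N) (τ (N + 1)), ENNReal.ofReal (b * Real.exp (-(2 * a)) ^ N) :=
          setLIntegral_mono' measurableSet_Ico fun t ht => by
            refine le_trans (hH ?_) (hdecay N)
            exact fun x hx => ⟨hx.1, (ENNReal.ofReal_le_ofReal ht.1).trans_lt hx.2⟩
      _ = ENNReal.ofReal (b * Real.exp (-(2 * a)) ^ N * (τ (N + 1) - τ N)) := by
          rw [setLIntegral_const, Real.volume_Ico, ← ENNReal.ofReal_mul (by positivity)]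
      _ ≤ ENNReal.ofReal (b * Real.exp (-(2 * a)) ^ N * τ (N + 1)) := by
          gcongr
          exact sub_le_self _ (Real.exp_pos _).le
      _ = _ := by
          simp only [hτ]
          rw [mul_assoc, mul_assoc, ← Real.exp_nat_mul, ← Real.exp_nat_mul, ← Real.exp_add,
            ← Real.exp_add]
          congr 3
          push_cast
          ring
  calc choquetIntegral H Ω F
      ≤ ∫⁻ t in Set.Ioo 0 (τ 0) ∪ ⋃ N, Set.Ico (τ N) (τ (N + 1)),
          H {x ∈ Ω | ENNReal.ofReal t < F x} := lintegral_mono_set hcover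
    _ ≤ _ + _ := lintegral_union_le _ _ _
    _ ≤ ENNReal.ofReal (Real.exp (a * S) * b) +
          ∑' N : ℕ, ENNReal.ofReal (b * Real.exp (a * (S + 1)) * Real.exp (-a) ^ N) :=
        add_le_add hinit ((lintegral_iUnion_le _ _).trans (ENNReal.tsum_le_tsum hstep))
    _ = _ := by
        rw [← ENNReal.ofReal_tsum_of_nonneg (fun k => by positivity)
          ((summable_geometric_of_lt_one (Real.exp_pos _).le hq).mul_left _), tsum_mul_left,
          tsum_geometric_of_lt_one (Real.exp_pos _).le hq, ← ENNReal.ofReal_add (by positivity)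
            (mul_nonneg (by positivity) (inv_nonneg.2 (by linarith)))]
        congr 1
        ring

theorem mainTheorem7 (d : ℕ) (α β : ℝ) (hα : 0 < α) (hαd : α < d)
    (hβ : (d : ℝ) - α < β) (hβd : β ≤ d) :
    ∃ C γ : ℝ, 0 < C ∧ 0 < γ ∧
      ∀ (μ : Measure (EuclideanSpace ℝ (Fin d))) [IsLocallyFiniteMeasure μ]
        (z : EuclideanSpace ℝ (Fin d)) (R : ℝ), 0 < R →
        morreyNorm ((d : ℝ) - α) μ (ball z R) < ∞ →
        (ENNReal.ofReal ((2 * R) ^ β))⁻¹ *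
          choquetIntegral (hausdorffContent β) (ball z (2 * R)) (fun x =>
            EReal.exp ((ENNReal.ofReal γ * rieszPotential α (μ.restrict (ball z R)) x /
              morreyNorm ((d : ℝ) - α) μ (ball z R) : ℝ≥0∞) : EReal)) ≤
        ENNReal.ofReal C := by
  have hs : 0 < (d : ℝ) - α := by linarith
  have hβ0 := hs.trans hβ
  have hω := contentConstant_pos hβ0
  have hc := rieszConstant_pos hα hαd
  set s := (d : ℝ) - α with hs_def
  set q : ℝ := (1 / 2) ^ (β - s) with hq_def
  have hq1 : q < 1 := Real.rpow_lt_one (by norm_num) (by norm_num) (by linarith)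
  set S := (1 - q)⁻¹ with hS
  have hS0 : 0 < S := inv_pos.2 (by linarith)
  -- Half the decay rate of the content, so that e^(-2a) = q.
  set a := (β - s) * Real.log 2 / 2 with ha_def
  have ha : 0 < a := by
    have := Real.log_pos one_lt_two
    have : 0 < β - s := by linarith
    positivity
  have hqa : Real.exp (-(2 * a)) = q := by
    rw [hq_def, Real.rpow_def_of_pos (by norm_num), one_div, Real.log_inv, ha_def]
    congr 1
    ring
  -- The first summand handles the content of 2B, the second the prefactor of the decay estimate.
  set b := contentConstant β * 2 ^ β + contentConstant β * 6 ^ β * 3 ^ (β - s) / 3 ^ s with hb_def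
  have hb : 0 < b := by positivity
  set D := Real.exp (a * S) + Real.exp (a * (S + 1)) * (1 - Real.exp (-a))⁻¹ with hD_def
  have hD : 0 < D := by
    have : 0 < 1 - Real.exp (-a) := sub_pos.2 (Real.exp_lt_one_iff.2 (by linarith))
    positivity
  -- This γ turns the level 2^s 3^s M (N + S) of the kernel integral into the exponent a (N + S).
  refine ⟨D * b / 2 ^ β, rieszConstant d α * a / (2 ^ s * 3 ^ s), by positivity, by positivity, ?_⟩
  intro μ _ z R hR hfin
  have hkey : choquetIntegral (hausdorffContent β) (ball z (2 * R)) (fun x =>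
      EReal.exp ((ENNReal.ofReal (rieszConstant d α * a / (2 ^ s * 3 ^ s)) *
        rieszPotential α (μ.restrict (ball z R)) x / morreyNorm s μ (ball z R) : ℝ≥0∞) : EReal)) ≤
      ENNReal.ofReal (D * (b * R ^ β)) := by
    refine choquetIntegral_le_of_exp_decay (fun _ _ h => hausdorffContent_mono β h) _ _ ha
      (by positivity) ?_ fun N => ?_
    · refine (hausdorffContent_ball_le hβ0 z (by positivity)).trans (ENNReal.ofReal_le_ofReal ?_)
      rw [Real.mul_rpow (by norm_num) hR.le, ← mul_assoc]
      gcongr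
      exact le_add_of_nonneg_right (by positivity)
    rw [hqa]
    -- If the norm vanishes, the quotient 0/0 is 0 in `ℝ≥0∞`, so the integrand is 1 and never
    -- exceeds a level e^(a(N+S)) ≥ 1.
    rcases eq_or_ne (morreyNorm s μ (ball z R)) 0 with h0 | h0
    · have hμ : μ.restrict (ball z R) = 0 := by
        have := measure_ball_inter_le_morreyNorm s μ (mem_ball_self (x := z) hR) hR
        rw [Set.inter_self, h0, zero_mul] at this
        exact Measure.restrict_eq_zero.2 (le_antisymm this zero_le)
      have hempty : ∀ x : EuclideanSpace ℝ (Fin d),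
          rieszPotential α (μ.restrict (ball z R)) x = 0 := fun x => by simp [rieszPotential, hμ]
      refine (hausdorffContent_mono β (B := ball z 0) fun x hx => ?_).trans
        ((hausdorffContent_ball_le hβ0 z le_rfl).trans ?_)
      · have h1 : (1 : ℝ) ≤ Real.exp (a * (N + S)) := Real.one_le_exp (by positivity)
        have h2 := hx.2
        rw [hempty, mul_zero, ENNReal.zero_div, EReal.coe_ennreal_zero, EReal.exp_zero] at h2
        exact absurd h2 (not_lt.2 (ENNReal.one_le_ofReal.2 h1))
      · simp [Real.zero_rpow hβ0.ne']
    · set M := (morreyNorm s μ (ball z R)).toReal with hM_def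
      have hM : morreyNorm s μ (ball z R) = ENNReal.ofReal M := (ENNReal.ofReal_toReal hfin.ne).symm
      have hM0 : 0 < M := ENNReal.toReal_pos h0 hfin.ne
      refine (hausdorffContent_mono β ?_).trans
        ((hausdorffContent_setOf_lt_lintegral_le hs hβ hM0 hR μ z hM N).trans
          (ENNReal.ofReal_le_ofReal ?_))
      · rintro x ⟨hx, hlt⟩
        refine ⟨hx, lt_of_not_ge fun hle => absurd hlt (not_lt.2 ?_)⟩
        rw [← EReal.exp_coe]
        refine EReal.exp_monotone ?_
        have hnn : 0 ≤ a * (N + S) := by positivity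
        -- Writing the real exponent as its maximum with 0 identifies it with a coerced
        -- `ENNReal.ofReal`, which moves the inequality from `EReal` to `ℝ≥0∞`.
        rw [← max_eq_left hnn, ← EReal.coe_ennreal_ofReal, EReal.coe_ennreal_le_coe_ennreal_iff, hM]
        refine ENNReal.div_le_of_le_mul ?_
        unfold rieszPotential
        rw [← ENNReal.ofReal_inv_of_pos hc]
        refine (mul_le_mul_right (mul_le_mul_right hle _) _).trans ?_
        rw [← ENNReal.ofReal_mul (by positivity), ← ENNReal.ofReal_mul (by positivity),
          ← ENNReal.ofReal_mul hnn]
        refine ENNReal.ofReal_le_ofReal (le_of_eq ?_)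
        have : 0 < (2 : ℝ) ^ s := by positivity
        have : 0 < (3 : ℝ) ^ s := by positivity
        rw [← hq_def, ← hS]
        field_simp
      · have : 0 < q := by positivity
        gcongr
        exact le_add_of_nonneg_left (by positivity)
  refine (mul_le_mul_right hkey _).trans ?_
  rw [← ENNReal.ofReal_inv_of_pos (by positivity), ← ENNReal.ofReal_mul (by positivity)]
  refine ENNReal.ofReal_le_ofReal (le_of_eq ?_)
  rw [Real.mul_rpow (by norm_num) hR.le]
  have : 0 < R ^ β := by positivity
  have : 0 < (2 : ℝ) ^ β := by positivity
  field_simp
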